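/- **Conventions.** Directed graphs are finite and may have parallel edges. A *progressive graph* is an acyclic directed graph all of whose sources (vertices without incoming edges) and sinks (vertices without outgoing edges) have degree one. For edges, $e_1\to e_2$ means that there is a directed path with at least two edges whose first edge is $e_1$ and whose last edge is $e_2$. A *planar order* on a progressive graph $G$ is a strict linear order $\prec$ on the edge set $E(G)$ such that * $(P_1)$ $e_1\to e_2$ implies $e_1\prec e_2$; * $(P_2)$ if $e_1\prec e_2\prec e_3$ and $e_1\to e_3$, then $e_1\to e_2$ or $e_2\to e_3$. A *BP-embedding* of $G$ is a planar embedding of $G$ (vertices go to distinct points, edges to simple arcs joining their end vertices, the interiors of the arcs contain no vertices and are pairwise disjoint) into a box $[l,r]\times[b,t]$ with $l<r$, $b<t$, such that all sources lie on one horizontal side of the box and all sinks on the other one. It is *upward* if the vertical coordinate strictly increases along every edge. **The induced order $\prec_\phi$.** Let $\phi$ be an upward BP-embedding of $G$. Cut the box along finitely many horizontal lines containing no vertex, such that every resulting layer is *elementary*, i.e. every connected component of the part of $G$ in the open strip contains at most one vertex of $G$. Order the edges in each layer as follows: the components are ordered from left to right; within a component with a vertex $v$, the incoming edges of $v$ come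 before its outgoing edges, and both sets are ordered from left to right. Compose these orders, starting with the layer next to the sources: if $c_1,\dots,c_n$ are the edges crossing a cut line, in order, and the orders before and after that line are $$Q_1\triangleleft\{c_1\}\triangleleft\cdots\triangleleft Q_n\triangleleft\{c_n\}\quad\text{and}\quad \{c_1\}\triangleleft P_1\triangleleft\cdots\triangleleft\{c_n\}\triangleleft P_n$$ (where $\triangleleft$ denotes concatenation), then their composition is $$Q_1\triangleleft\{c_1\}\triangleleft P_1\triangleleft\cdots\triangleleft Q_n\triangleleft\{c_n\}\triangleleft P_n .$$ One says that $\phi$ induces the order $\prec$, written $\prec_\phi=\prec$, if such a decomposition of $\phi$ exists and every such decomposition yields $\prec$. **Proposition.** Let $G$ be a progressive graph. For every planar order $\prec$ on $G$ there is an upward BP-embedding $\phi$ of $G$ with $\prec_\phi=\prec$. -/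

import Mathlib

/-- A directed graph with vertex type `V` and edge type `E` (parallel edges are allowed). -/
structure DirGraph (V : Type*) (E : Type*) where
  /-- the starting vertex of an edge -/
  src : E → V
  /-- the ending vertex of an edge -/
  tgt : E → V

namespace DirGraph

variable {V E : Type*}

/-- `e₁ → e₂`: there is a directed path (with at least two edges) whose first edge is `e₁` and
whose last edge is `e₂`. -/
def EdgeReach (G : DirGraph V E) : E → E → Prop :=
  Relation.TransGen (fun e f => G.tgt e = G.src f)

/-- There is no directed cycle. -/
def IsAcyclic (G : DirGraph V E) : Prop := ∀ e, ¬ G.EdgeReach e e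

/-- A source is a vertex without incoming edges. -/
def IsSource (G : DirGraph V E) (v : V) : Prop := ∀ e, G.tgt e ≠ v

/-- A sink is a vertex without outgoing edges. -/
def IsSink (G : DirGraph V E) (v : V) : Prop := ∀ e, G.src e ≠ v

/-- The degree of a vertex: number of incoming plus number of outgoing edges. -/
noncomputable def degree (G : DirGraph V E) (v : V) : ℕ :=
  {e | G.tgt e = v}.ncard + {e | G.src e = v}.ncard

/-- A progressive graph: an acyclic directed graph all of whose sources and sinks have degree
one. -/
structure IsProgressive (G : DirGraph V E) : Prop where
  acyclic : G.IsAcyclic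
  degree_source : ∀ v, G.IsSource v → G.degree v = 1
  degree_sink : ∀ v, G.IsSink v → G.degree v = 1

/-- A planar order on `G`: a (strict) linear order on the edge set with properties
(P₁) and (P₂). -/
structure IsPlanarOrder (G : DirGraph V E) (r : E → E → Prop) : Prop where
  isStrictTotalOrder : IsStrictTotalOrder E r
  P₁ : ∀ e₁ e₂, G.EdgeReach e₁ e₂ → r e₁ e₂
  P₂ : ∀ e₁ e₂ e₃, r e₁ e₂ → r e₂ e₃ → G.EdgeReach e₁ e₃ →
    G.EdgeReach e₁ e₂ ∨ G.EdgeReach e₂ e₃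

/-- The edge `e` is incident with the vertex `v`. -/
def Inc (G : DirGraph V E) (e : E) (v : V) : Prop := G.src e = v ∨ G.tgt e = v

/-- A planar embedding: vertices are sent to distinct points of the plane, edges to simple arcs
joining their end vertices, the interior of an arc contains no vertex, and the interiors of
different arcs are disjoint. -/
structure PlanarEmbedding (G : DirGraph V E) where
  pos : V → ℝ × ℝ
  curve : ∀ e : E, Path (pos (G.src e)) (pos (G.tgt e))
  pos_injective : Function.Injective pos
  curve_injective : ∀ e, Function.Injective (curve e)
  curve_ne_pos : ∀ e v, ∀ s ∈ Set.Ioo (0 : unitInterval) 1, curve e s ≠ pos v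
  curve_disjoint : ∀ e f, ∀ s ∈ Set.Ioo (0 : unitInterval) 1,
    ∀ t ∈ Set.Ioo (0 : unitInterval) 1, curve e s = curve f t → e = f

/-- A boxed planar embedding: a planar embedding into a box `[left, right] × [bottom, top]` with
all sources on one horizontal side and all sinks on the other horizontal side. -/
structure BPEmbedding (G : DirGraph V E) extends PlanarEmbedding G where
  left : ℝ
  right : ℝ
  bottom : ℝ
  top : ℝ
  left_lt_right : left < right
  bottom_lt_top : bottom < top
  pos_mem : ∀ v, pos v ∈ Set.Icc left right ×ˢ Set.Icc bottom top
  curve_mem : ∀ e s, curve e s ∈ Set.Icc left right ×ˢ Set.Icc bottom top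
  sides :
    ((∀ v, G.IsSource v → (pos v).2 = bottom) ∧ (∀ v, G.IsSink v → (pos v).2 = top)) ∨
    ((∀ v, G.IsSource v → (pos v).2 = top) ∧ (∀ v, G.IsSink v → (pos v).2 = bottom))

/-- The composition (shuffle) of an order `r₁` on the edge set `A` of a first graph and an order
`r₂` on the edge set `B` of a second graph, where the output edges of the first graph are glued to
the input edges of the second one, so that `A ∩ B = {c₁, …, cₙ}` consists of the glued edges.
If `r₁` is `Q₁ ◁ {c₁} ◁ ⋯ ◁ Qₙ ◁ {cₙ}` and `r₂` is `{c₁} ◁ P₁ ◁ ⋯ ◁ {cₙ} ◁ Pₙ`, then this is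
`Q₁ ◁ {c₁} ◁ P₁ ◁ ⋯ ◁ Qₙ ◁ {cₙ} ◁ Pₙ`: an element `x` of `Q_j` comes before an element `y` of
`P_k` iff `j ≤ k`, i.e. iff `x` comes before some `c` and this `c` comes before `y`. -/
def composeOrder (A B : Set E) (r₁ r₂ : E → E → Prop) (x y : E) : Prop :=
  (x ∈ A ∧ y ∈ A ∧ r₁ x y) ∨
  (x ∈ B ∧ y ∈ B ∧ r₂ x y) ∨
  (x ∈ A \ B ∧ y ∈ B \ A ∧ ∃ c ∈ A ∩ B, r₁ x c ∧ r₂ c y) ∨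
  (x ∈ B \ A ∧ y ∈ A \ B ∧ ¬ ∃ c ∈ A ∩ B, r₁ y c ∧ r₂ c x)

namespace BPEmbedding

variable {G : DirGraph V E}

/-- Upward: along every edge the vertical coordinate increases strictly. -/
def IsUpward (φ : G.BPEmbedding) : Prop :=
  ∀ e, StrictMono (fun s => (φ.curve e s).2)

/-- The edges of the layer of `φ` in the open horizontal strip `a < y < b`. -/
def layerEdges (φ : G.BPEmbedding) (a b : ℝ) : Set E :=
  {e | ∃ s, (φ.curve e s).2 ∈ Set.Ioo a b}

/-- The vertices in the open strip `a < y < b`; they are the internal vertices of the layer (the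
boundary vertices of the layer are the points where edges meet the lines `y = a` and `y = b`). -/
def layerVerts (φ : G.BPEmbedding) (a b : ℝ) : Set V :=
  {v | (φ.pos v).2 ∈ Set.Ioo a b}

/-- Two edges lie in the same connected component of the layer `a < y < b`. -/
def LayerConn (φ : G.BPEmbedding) (a b : ℝ) : E → E → Prop :=
  Relation.EqvGen (fun e f => ∃ v ∈ φ.layerVerts a b, G.Inc e v ∧ G.Inc f v)

/-- The layer `a < y < b` is elementary: each of its connected components contains at most one
internal vertex. -/
def IsElementaryLayer (φ : G.BPEmbedding) (a b : ℝ) : Prop :=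
  ∀ u ∈ φ.layerVerts a b, ∀ v ∈ φ.layerVerts a b, ∀ e f,
    G.Inc e u → G.Inc f v → φ.LayerConn a b e f → u = v

/-- At some height inside the strip `a < y < b`, the edge `e` is to the left of the edge `f`. -/
def LeftOf (φ : G.BPEmbedding) (a b : ℝ) (e f : E) : Prop :=
  ∃ s t, (φ.curve e s).2 ∈ Set.Ioo a b ∧ (φ.curve f t).2 = (φ.curve e s).2 ∧
    (φ.curve e s).1 < (φ.curve f t).1

/-- The order on the edges of an elementary layer (of an upward embedding). Every component is a
single edge or has exactly one internal vertex `v`. The components are ordered from left to right;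
inside a component, the incoming edges of `v` come before the outgoing edges of `v`, and both are
ordered from left to right. -/
def layerOrder (φ : G.BPEmbedding) (a b : ℝ) (e f : E) : Prop :=
  e ∈ φ.layerEdges a b ∧ f ∈ φ.layerEdges a b ∧
  ((φ.LayerConn a b e f ∧ ∃ v ∈ φ.layerVerts a b,
      (G.tgt e = v ∧ G.src f = v) ∨
      (G.tgt e = v ∧ G.tgt f = v ∧ φ.LeftOf a b e f) ∨
      (G.src e = v ∧ G.src f = v ∧ φ.LeftOf a b e f)) ∨
   (¬ φ.LayerConn a b e f ∧
      ∃ e' f', φ.LayerConn a b e e' ∧ φ.LayerConn a b f f' ∧ φ.LeftOf a b e' f'))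

/-- A decomposition of `φ` into elementary layers: the box is cut along finitely many horizontal
lines that contain no vertices, such that every resulting layer is elementary. The layers are the
strips `height k < y < height (k + 1)` for `k = 0, …, n`; the values `height k` for `k > n + 1`
play no role. -/
structure ElementaryDecomposition (φ : G.BPEmbedding) where
  n : ℕ
  height : ℕ → ℝ
  height_zero : height 0 = φ.bottom
  height_last : height (n + 1) = φ.top
  height_lt : ∀ k ≤ n, height k < height (k + 1)
  no_vertex : ∀ k, 1 ≤ k → k ≤ n → ∀ v, (φ.pos v).2 ≠ height k
  elementary : ∀ k ≤ n, φ.IsElementaryLayer (height k) (height (k + 1))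

/-- The composition of the orders of the layers `0, …, k`. -/
def composedOrder (φ : G.BPEmbedding) (h : ℕ → ℝ) : ℕ → E → E → Prop
  | 0 => φ.layerOrder (h 0) (h 1)
  | k + 1 => composeOrder (φ.layerEdges (h 0) (h (k + 1)))
      (φ.layerEdges (h (k + 1)) (h (k + 2)))
      (composedOrder φ h k) (φ.layerOrder (h (k + 1)) (h (k + 2)))

/-- The order on the edges of `G` obtained from a decomposition into elementary layers by composing
the orders of all layers. -/
def ElementaryDecomposition.order {φ : G.BPEmbedding} (d : φ.ElementaryDecomposition) :
    E → E → Prop :=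
  φ.composedOrder d.height d.n

/-- The order `≺_φ` induced by the upward BP-embedding `φ` exists and is `r`: there is a
decomposition of `φ` into elementary layers, and the composition of the orders of the layers is
`r`, whichever such decomposition is taken. -/
def Induces (φ : G.BPEmbedding) (r : E → E → Prop) : Prop :=
  Nonempty φ.ElementaryDecomposition ∧ ∀ d : φ.ElementaryDecomposition, d.order = r

end BPEmbedding

end DirGraph

/-! ### Directed paths, sources and sinks. -/

namespace DirGraph

variable {V E : Type*} {G : DirGraph V E}

/-! Number the edges along `r` and let the edge of rank `i` run vertically in column `i`, except
near its ends. An inner vertex is drawn at height one plus the rank of its last incoming edge,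
sources at height 0 and sinks at the top; each vertex sits in the column of one incident edge, and
the other edges at it bend over to it.

Why nothing crosses: an edge `f` passing the height of an inner vertex `v` is joined by no directed
path to an edge at `v`. By P₂ all edges at `v` then lie on the same side of `f` in `r`
(`IsPlanarOrder.lt_of_inc`), so bending them towards one of their columns never meets `f`. Hence at
every height the left-to-right order agrees with `r` (`LevelData.abscissa_lt`), which is the
property `Realizes`.

Why such a drawing induces `r`: in an elementary layer the same one-sidedness, applied to whole
components, shows that the layer order is the restriction of `r` (`Realizes.layerOrder_iff`). P₂
also supplies, between an edge below a cut and a later edge above it, an edge crossing the cut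
(`Realizes.exists_rel_cut`), so composition again gives restrictions of `r`
(`Realizes.composeOrder_iff`). Induction over the layers finishes. -/

lemma EdgeReach.le_of_lt {α : Type*} [Preorder α] {h : V → α}
    (hh : ∀ e, h (G.src e) < h (G.tgt e)) {e f : E} (hef : G.EdgeReach e f) :
    h (G.tgt e) ≤ h (G.src f) := by
  induction hef with
  | single h1 => exact (congrArg h h1).le
  | tail _ h1 ih => exact ih.trans ((hh _).le.trans (congrArg h h1).le)

/-- Heights never decrease along a path, so a path between `f` and an edge at `v` would put the
height of `v` outside the range of `f`. -/
lemma not_edgeReach_of_between {α : Type*} [Preorder α] {h : V → α}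
    (hh : ∀ e, h (G.src e) < h (G.tgt e)) {v : V} {f g : E} (h1 : h (G.src f) < h v)
    (h2 : h v < h (G.tgt f)) (hg : G.Inc g v) : ¬ G.EdgeReach g f ∧ ¬ G.EdgeReach f g := by
  have h3 := hh g
  constructor
  · intro hr
    have := hr.le_of_lt hh
    rcases hg with rfl | rfl
    · exact lt_irrefl _ ((h3.trans_le this).trans h1)
    · exact lt_irrefl _ (this.trans_lt h1)
  · intro hr
    have := hr.le_of_lt hh
    rcases hg with rfl | rfl
    · exact lt_irrefl _ (this.trans_lt h2)
    · exact lt_irrefl _ ((h2.trans_le this).trans h3)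

lemma IsSource.eq_of_inc (hG : G.IsProgressive) {v : V} (hv : G.IsSource v) {e f : E}
    (he : G.Inc e v) (hf : G.Inc f v) : e = f := by
  have h := hG.degree_source v hv
  have h0 : {e | G.tgt e = v} = ∅ := Set.eq_empty_of_forall_notMem hv
  rw [degree, h0, Set.ncard_empty, zero_add, Set.ncard_eq_one] at h
  obtain ⟨g, hg⟩ := h
  have key : ∀ e, G.Inc e v → e = g := fun e he => by
    have : e ∈ {e | G.src e = v} := he.resolve_right (hv e)
    rwa [hg] at this
  rw [key e he, key f hf]

lemma IsSink.eq_of_inc (hG : G.IsProgressive) {v : V} (hv : G.IsSink v) {e f : E}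
    (he : G.Inc e v) (hf : G.Inc f v) : e = f := by
  have h := hG.degree_sink v hv
  have h0 : {e | G.src e = v} = ∅ := Set.eq_empty_of_forall_notMem hv
  rw [degree, h0, Set.ncard_empty, add_zero, Set.ncard_eq_one] at h
  obtain ⟨g, hg⟩ := h
  have key : ∀ e, G.Inc e v → e = g := fun e he => by
    have : e ∈ {e | G.tgt e = v} := he.resolve_left (hv e)
    rwa [hg] at this
  rw [key e he, key f hf]

lemma IsProgressive.not_isSink_of_isSource (hG : G.IsProgressive) {v : V} (hv : G.IsSource v) :
    ¬ G.IsSink v := by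
  intro hs
  have h := hG.degree_source v hv
  have h0 : {e | G.tgt e = v} = ∅ := Set.eq_empty_of_forall_notMem hv
  have h1 : {e | G.src e = v} = ∅ := Set.eq_empty_of_forall_notMem hs
  simp [degree, h0, h1] at h

lemma IsProgressive.exists_inc (hG : G.IsProgressive) (v : V) : ∃ e, G.Inc e v := by
  by_cases hv : G.IsSource v
  · have := hG.not_isSink_of_isSource hv
    simp only [IsSink, not_forall, not_not] at this
    obtain ⟨e, he⟩ := this
    exact ⟨e, Or.inl he⟩
  · simp only [IsSource, not_forall, not_not] at hv
    obtain ⟨e, he⟩ := hv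
    exact ⟨e, Or.inr he⟩

/-! ### One-sidedness at a vertex. -/

namespace IsPlanarOrder

variable {r : E → E → Prop}

lemma trans (hr : G.IsPlanarOrder r) {e f g : E} (h1 : r e f) (h2 : r f g) : r e g :=
  hr.isStrictTotalOrder.toIsStrictOrder.toIsTrans.trans _ _ _ h1 h2

lemma irrefl (hr : G.IsPlanarOrder r) (e : E) : ¬ r e e :=
  hr.isStrictTotalOrder.toIsStrictOrder.toIrrefl.irrefl e

lemma asymm (hr : G.IsPlanarOrder r) {e f : E} (h1 : r e f) : ¬ r f e :=
  fun h2 => hr.irrefl e (hr.trans h1 h2)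

lemma lt_or_eq_or_gt (hr : G.IsPlanarOrder r) (e f : E) : r e f ∨ e = f ∨ r f e :=
  haveI := hr.isStrictTotalOrder
  trichotomous_of r e f

/-- An edge that is not joined by a directed path to any edge at the inner vertex `v` comes either
before or after all edges at `v`. -/
lemma lt_of_inc (hr : G.IsPlanarOrder r) {v : V} (h1 : ¬ G.IsSource v) (h2 : ¬ G.IsSink v) {f : E}
    (hf : ∀ g, G.Inc g v → ¬ G.EdgeReach g f ∧ ¬ G.EdgeReach f g) {e e' : E}
    (he : G.Inc e v) (he' : G.Inc e' v) : (r e f → r e' f) ∧ (r f e → r f e') := by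
  simp only [IsSource, IsSink, not_forall, not_not] at h1 h2
  obtain ⟨i₀, hi₀⟩ := h1
  obtain ⟨o₀, ho₀⟩ := h2
  have reach : ∀ i o, G.tgt i = v → G.src o = v → G.EdgeReach i o := fun i o hi ho =>
    Relation.TransGen.single (hi.trans ho.symm)
  -- If `f` fell between `i` and `o`, P₂ applied to `i → o` would join `f` to one of them by a path.
  have up : ∀ i o, G.tgt i = v → G.src o = v → r i f → r o f := by
    intro i o hi ho h
    rcases hr.lt_or_eq_or_gt o f with h' | rfl | h'
    · exact h'
    · exact absurd (reach i o hi ho) (hf i (Or.inr hi)).1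
    · rcases hr.P₂ i f o h h' (reach i o hi ho) with h'' | h''
      · exact absurd h'' (hf i (Or.inr hi)).1
      · exact absurd h'' (hf o (Or.inl ho)).2
  have lt : ∀ i o, G.tgt i = v → G.src o = v → r i o := fun i o hi ho =>
    hr.P₁ _ _ (reach i o hi ho)
  have main : ∀ e e', G.Inc e v → G.Inc e' v → r e f → r e' f := by
    rintro e e' (he | he) (he' | he') h
    · exact up i₀ e' hi₀ he' (hr.trans (lt i₀ e hi₀ he) h)
    · exact hr.trans (lt e' e he' he) h
    · exact up e e' he he' h
    · exact hr.trans (lt e' o₀ he' ho₀) (up e o₀ he ho₀ h)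
  refine ⟨main e e' he he', fun h => ?_⟩
  -- The second implication follows from the first by linearity; `f` itself cannot be an edge at
  -- `v`, since it would then be joined to `i₀` or `o₀`.
  rcases hr.lt_or_eq_or_gt e' f with h' | rfl | h'
  · exact absurd h (hr.asymm (main e' e he' he h'))
  · rcases he' with he' | he'
    · exact absurd (reach i₀ _ hi₀ he') (hf i₀ (Or.inr hi₀)).1
    · exact absurd (reach _ o₀ he' ho₀) (hf o₀ (Or.inl ho₀)).2
  · exact h'

end IsPlanarOrder

/-! ### Upward embeddings and their layers. -/

namespace BPEmbedding

variable {φ : G.BPEmbedding}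

lemma IsUpward.src_lt_tgt (hφ : φ.IsUpward) (e : E) :
    (φ.pos (G.src e)).2 < (φ.pos (G.tgt e)).2 := by
  have := hφ e (show (0 : unitInterval) < 1 from zero_lt_one)
  simpa using this

lemma IsUpward.src_le (hφ : φ.IsUpward) (e : E) (s : unitInterval) :
    (φ.pos (G.src e)).2 ≤ (φ.curve e s).2 := by
  have := (hφ e).monotone (show (0 : unitInterval) ≤ s from s.2.1)
  simpa using this

lemma IsUpward.le_tgt (hφ : φ.IsUpward) (e : E) (s : unitInterval) :
    (φ.curve e s).2 ≤ (φ.pos (G.tgt e)).2 := by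
  have := (hφ e).monotone (show s ≤ (1 : unitInterval) from s.2.2)
  simpa using this

lemma exists_height_eq (φ : G.BPEmbedding) (e : E) {y : ℝ} (h1 : (φ.pos (G.src e)).2 ≤ y)
    (h2 : y ≤ (φ.pos (G.tgt e)).2) : ∃ s, (φ.curve e s).2 = y := by
  have hc : Continuous fun s => (φ.curve e s).2 := by fun_prop
  exact mem_range_of_exists_le_of_exists_ge hc ⟨0, by simpa using h1⟩ ⟨1, by simpa using h2⟩

lemma exists_mem_Ioo_height_eq (φ : G.BPEmbedding) (e : E) {y : ℝ} (h1 : (φ.pos (G.src e)).2 < y)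
    (h2 : y < (φ.pos (G.tgt e)).2) :
    ∃ s ∈ Set.Ioo (0 : unitInterval) 1, (φ.curve e s).2 = y := by
  obtain ⟨s, hs⟩ := φ.exists_height_eq e h1.le h2.le
  refine ⟨s, ⟨lt_of_le_of_ne s.2.1 ?_, lt_of_le_of_ne s.2.2 ?_⟩, hs⟩
  · intro h
    have h0 : s = 0 := h.symm
    subst h0
    simp at hs
    exact h1.ne hs
  · intro h
    have h0 : s = 1 := h
    subst h0
    simp at hs
    exact h2.ne hs.symm

/-- Reduces all later questions about layers to the heights of end vertices. -/
lemma IsUpward.mem_layerEdges (hφ : φ.IsUpward) {a b : ℝ} (hab : a < b) {e : E} :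
    e ∈ φ.layerEdges a b ↔ (φ.pos (G.src e)).2 < b ∧ a < (φ.pos (G.tgt e)).2 := by
  constructor
  · rintro ⟨s, h1, h2⟩
    exact ⟨(hφ.src_le e s).trans_lt h2, h1.trans_le (hφ.le_tgt e s)⟩
  · rintro ⟨h1, h2⟩
    have : max a (φ.pos (G.src e)).2 < min b (φ.pos (G.tgt e)).2 :=
      max_lt (lt_min hab h2) (lt_min h1 (hφ.src_lt_tgt e))
    obtain ⟨y, hy1, hy2⟩ := exists_between this
    obtain ⟨s, hs⟩ := φ.exists_height_eq e ((le_max_right _ _).trans hy1.le)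
      (hy2.le.trans (min_le_right _ _))
    exact ⟨s, hs ▸ (le_max_left _ _).trans_lt hy1, hs ▸ hy2.trans_le (min_le_left _ _)⟩

lemma mem_layerEdges_of_inc {a b : ℝ} {v : V}
    (hv : v ∈ φ.layerVerts a b) {e : E} (he : G.Inc e v) : e ∈ φ.layerEdges a b := by
  rcases he with rfl | rfl
  · exact ⟨0, by simpa [layerVerts] using hv⟩
  · exact ⟨1, by simpa [layerVerts] using hv⟩

lemma mem_Ioo_or_exists_inc (φ : G.BPEmbedding) (e : E) (s : unitInterval) :
    s ∈ Set.Ioo 0 1 ∨ ∃ v, G.Inc e v ∧ φ.curve e s = φ.pos v := by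
  rcases eq_or_ne s 0 with rfl | h0
  · exact Or.inr ⟨_, Or.inl rfl, by simp⟩
  rcases eq_or_ne s 1 with rfl | h1
  · exact Or.inr ⟨_, Or.inr rfl, by simp⟩
  exact Or.inl ⟨lt_of_le_of_ne s.2.1 fun h => h0 h.symm, lt_of_le_of_ne s.2.2 h1⟩

/-- Two edges meeting in an open strip belong to the same component of that layer. -/
lemma layerConn_of_curve_eq (φ : G.BPEmbedding) {a b : ℝ} {e f : E} {s t : unitInterval}
    (hs : (φ.curve e s).2 ∈ Set.Ioo a b) (h : φ.curve e s = φ.curve f t) :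
    φ.LayerConn a b e f := by
  rcases φ.mem_Ioo_or_exists_inc e s with hs' | ⟨v, hv, hv'⟩ <;>
    rcases φ.mem_Ioo_or_exists_inc f t with ht' | ⟨w, hw, hw'⟩
  · obtain rfl := φ.curve_disjoint e f s hs' t ht' h
    exact Relation.EqvGen.refl _
  · exact absurd (h.trans hw') (φ.curve_ne_pos e w s hs')
  · exact absurd (h.symm.trans hv') (φ.curve_ne_pos f v t ht')
  · obtain rfl := φ.pos_injective (hv'.symm.trans (h.trans hw'))
    exact Relation.EqvGen.rel _ _ ⟨v, by rwa [hv'] at hs, hv, hw⟩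

/-- The inner vertices of the path have heights between the two given bounds, so each of them lies
in the strip and links consecutive edges. -/
lemma IsUpward.layerConn_of_edgeReach (hφ : φ.IsUpward) {a b : ℝ} {e f : E}
    (h : G.EdgeReach e f) (he : a < (φ.pos (G.tgt e)).2) (hf : (φ.pos (G.src f)).2 < b) :
    φ.LayerConn a b e f := by
  induction h with
  | single h1 =>
    exact Relation.EqvGen.rel _ _ ⟨_, ⟨he, by rwa [h1]⟩, Or.inr rfl, Or.inl h1.symm⟩
  | @tail g f h0 h1 ih =>
    have h2 : (φ.pos (G.tgt g)).2 < b := by rwa [h1]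
    refine Relation.EqvGen.trans _ _ _ (ih ((hφ.src_lt_tgt g).trans h2))
      (Relation.EqvGen.rel _ _ ⟨G.tgt g, ⟨?_, h2⟩, Or.inr rfl, Or.inl h1.symm⟩)
    exact he.trans_le ((EdgeReach.le_of_lt (h := fun v => (φ.pos v).2) hφ.src_lt_tgt h0).trans
      (hφ.src_lt_tgt g).le)

/-- A chain of edges collapses: two consecutive linking vertices share an edge, hence coincide in an
elementary layer. -/
lemma IsElementaryLayer.eq_or_exists_inc {a b : ℝ} (hel : φ.IsElementaryLayer a b) {e f : E}
    (h : φ.LayerConn a b e f) :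
    e = f ∨ ∃ v ∈ φ.layerVerts a b, G.Inc e v ∧ G.Inc f v := by
  induction h with
  | rel _ _ h => exact Or.inr h
  | refl => exact Or.inl rfl
  | symm _ _ _ ih =>
    rcases ih with rfl | ⟨v, h1, h2, h3⟩
    · exact Or.inl rfl
    · exact Or.inr ⟨v, h1, h3, h2⟩
  | trans _ g _ _ _ ih1 ih2 =>
    rcases ih1 with rfl | ⟨v, h1, h2, h3⟩
    · exact ih2
    rcases ih2 with rfl | ⟨w, h4, h5, h6⟩
    · exact Or.inr ⟨v, h1, h2, h3⟩
    obtain rfl := hel v h1 w h4 g g h3 h5 (Relation.EqvGen.refl _)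
    exact Or.inr ⟨v, h1, h2, h6⟩

lemma IsElementaryLayer.mem_layerEdges {a b : ℝ} (hel : φ.IsElementaryLayer a b) {e f : E}
    (he : e ∈ φ.layerEdges a b) (hef : φ.LayerConn a b e f) : f ∈ φ.layerEdges a b := by
  rcases hel.eq_or_exists_inc hef with rfl | ⟨v, hv, -, h⟩
  · exact he
  · exact mem_layerEdges_of_inc hv h

lemma exists_cut_of_edgeReach (φ : G.BPEmbedding) {c : ℝ} (hc : ∀ v, (φ.pos v).2 ≠ c)
    {x y : E} (hxy : G.EdgeReach x y) (hx : (φ.pos (G.tgt x)).2 < c)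
    (hy : c < (φ.pos (G.src y)).2) :
    ∃ g, G.EdgeReach x g ∧ G.EdgeReach g y ∧
      (φ.pos (G.src g)).2 < c ∧ c < (φ.pos (G.tgt g)).2 := by
  induction hxy with
  | single h => exact absurd (hx.trans hy) (by rw [h]; exact lt_irrefl _)
  | @tail g y h1 h2 ih =>
    rcases lt_or_gt_of_ne (hc (G.src g)) with h | h
    · exact ⟨g, h1, Relation.TransGen.single h2, h, by rwa [h2]⟩
    · obtain ⟨k, h3, h4, h5⟩ := ih h
      exact ⟨k, h3, h4.tail h2, h5⟩

/-! ### Recovering the planar order from the layers. -/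

/-- The upward embedding `φ` has its sources at the bottom, its sinks at the top, and at every
height the left-to-right order of the edges agrees with `r`. -/
structure Realizes (φ : G.BPEmbedding) (r : E → E → Prop) : Prop where
  upward : φ.IsUpward
  source : ∀ v, G.IsSource v → (φ.pos v).2 = φ.bottom
  sink : ∀ v, G.IsSink v → (φ.pos v).2 = φ.top
  rel_of_left : ∀ e f s t, (φ.curve f t).2 = (φ.curve e s).2 →
    (φ.curve e s).1 < (φ.curve f t).1 → r e f

namespace Realizes

variable {r : E → E → Prop} {a b : ℝ}

lemma rel_of_leftOf (hφ : φ.Realizes r) {e f : E} (h : φ.LeftOf a b e f) : r e f := by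
  obtain ⟨s, t, -, h1, h2⟩ := h
  exact hφ.rel_of_left e f s t h1 h2

lemma not_isSource (hφ : φ.Realizes r) (ha : φ.bottom ≤ a) {v : V} (hv : v ∈ φ.layerVerts a b) :
    ¬ G.IsSource v := fun h => (ha.trans_lt hv.1).ne' (hφ.source v h)

lemma not_isSink (hφ : φ.Realizes r) (hb : b ≤ φ.top) {v : V} (hv : v ∈ φ.layerVerts a b) :
    ¬ G.IsSink v := fun h => (hv.2.trans_le hb).ne (hφ.sink v h)

/-- Edges crossing a common height inside the strip are ordered from left to right by `r`. -/
lemma leftOf_of_rel (hφ : φ.Realizes r) (hr : G.IsPlanarOrder r) {e f : E} (hef : r e f)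
    {s t : unitInterval} (hs : (φ.curve e s).2 ∈ Set.Ioo a b)
    (ht : (φ.curve f t).2 = (φ.curve e s).2) (hne : φ.curve e s ≠ φ.curve f t) :
    φ.LeftOf a b e f := by
  refine ⟨s, t, hs, ht, ?_⟩
  rcases lt_trichotomy (φ.curve e s).1 (φ.curve f t).1 with h | h | h
  · exact h
  · exact absurd (Prod.ext h ht.symm) hne
  · exact absurd hef (hr.asymm (hφ.rel_of_left f e t s ht.symm h))

lemma leftOf_of_rel_of_between (hφ : φ.Realizes r) (hr : G.IsPlanarOrder r) {e f : E}
    (hef : r e f) {y z : ℝ} (hyz : y < z) (hay : a ≤ y) (hzb : z ≤ b)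
    (h1 : (φ.pos (G.src e)).2 ≤ y) (h2 : (φ.pos (G.src f)).2 ≤ y)
    (h3 : z ≤ (φ.pos (G.tgt e)).2) (h4 : z ≤ (φ.pos (G.tgt f)).2) : φ.LeftOf a b e f := by
  obtain ⟨x, hx1, hx2⟩ := exists_between hyz
  obtain ⟨s, hs, hs'⟩ := φ.exists_mem_Ioo_height_eq e (h1.trans_lt hx1) (hx2.trans_le h3)
  obtain ⟨t, ht, ht'⟩ := φ.exists_mem_Ioo_height_eq f (h2.trans_lt hx1) (hx2.trans_le h4)
  refine hφ.leftOf_of_rel hr hef (s := s) (t := t) ?_ (ht'.trans hs'.symm) ?_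
  · rw [hs']
    exact ⟨hay.trans_lt hx1, hx2.trans_le hzb⟩
  · intro h
    exact hr.irrefl e (by simpa [← φ.curve_disjoint e f s hs t ht h] using hef)

lemma leftOf_of_tgt_eq (hφ : φ.Realizes r) (hr : G.IsPlanarOrder r) {v : V}
    (hv : v ∈ φ.layerVerts a b) {e f : E} (he : G.tgt e = v) (hf : G.tgt f = v) (hef : r e f) :
    φ.LeftOf a b e f := by
  have h1 := hφ.upward.src_lt_tgt e
  have h2 := hφ.upward.src_lt_tgt f
  rw [he] at h1
  rw [hf] at h2
  exact hφ.leftOf_of_rel_of_between hr hef (y := max a (max _ _))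
    (max_lt hv.1 (max_lt h1 h2)) (le_max_left _ _) hv.2.le
    ((le_max_left _ _).trans (le_max_right _ _)) ((le_max_right _ _).trans (le_max_right _ _))
    (by rw [he]) (by rw [hf])

lemma leftOf_of_src_eq (hφ : φ.Realizes r) (hr : G.IsPlanarOrder r) {v : V}
    (hv : v ∈ φ.layerVerts a b) {e f : E} (he : G.src e = v) (hf : G.src f = v) (hef : r e f) :
    φ.LeftOf a b e f := by
  have h1 := hφ.upward.src_lt_tgt e
  have h2 := hφ.upward.src_lt_tgt f
  rw [he] at h1
  rw [hf] at h2
  exact hφ.leftOf_of_rel_of_between hr hef (z := min b (min _ _))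
    (lt_min hv.2 (lt_min h1 h2)) hv.1.le (min_le_left _ _) (by rw [he]) (by rw [hf])
    ((min_le_right _ _).trans (min_le_left _ _)) ((min_le_right _ _).trans (min_le_right _ _))

/-- A component of an elementary layer reaches every height of the layer. -/
lemma exists_layerConn_height_eq (hφ : φ.Realizes r) (hel : φ.IsElementaryLayer a b)
    (ha : φ.bottom ≤ a) (hb : b ≤ φ.top) {e : E} (he : e ∈ φ.layerEdges a b) {y : ℝ}
    (hy : y ∈ Set.Ioo a b) : ∃ e' s, φ.LayerConn a b e e' ∧ (φ.curve e' s).2 = y := by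
  obtain ⟨h1, h2⟩ := (hφ.upward.mem_layerEdges (hy.1.trans hy.2)).1 he
  rcases lt_or_ge (φ.pos (G.tgt e)).2 y with h3 | h3
  · have hv : G.tgt e ∈ φ.layerVerts a b := ⟨h2, h3.trans hy.2⟩
    have hs := hφ.not_isSink hb hv
    simp only [IsSink, not_forall, not_not] at hs
    obtain ⟨o, ho⟩ := hs
    have hc : φ.LayerConn a b e o := Relation.EqvGen.rel _ _ ⟨_, hv, Or.inr rfl, Or.inl ho⟩
    have h4 := hφ.upward.src_lt_tgt o
    -- If `o` ended inside the strip, its two ends would be distinct vertices of one component.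
    have h5 : b ≤ (φ.pos (G.tgt o)).2 := by
      by_contra! h6
      have := hel _ hv (G.tgt o) ⟨h2.trans (ho ▸ h4), h6⟩ e o (Or.inr rfl) (Or.inr rfl) hc
      rw [ho, this] at h4
      exact lt_irrefl _ h4
    obtain ⟨s, hs⟩ := φ.exists_height_eq o (y := y) (by rw [ho]; exact h3.le) (hy.2.le.trans h5)
    exact ⟨o, s, hc, hs⟩
  rcases lt_or_ge y (φ.pos (G.src e)).2 with h4 | h4
  · have hv : G.src e ∈ φ.layerVerts a b := ⟨hy.1.trans h4, h1⟩
    have hs := hφ.not_isSource ha hv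
    simp only [IsSource, not_forall, not_not] at hs
    obtain ⟨o, ho⟩ := hs
    have hc : φ.LayerConn a b e o := Relation.EqvGen.rel _ _ ⟨_, hv, Or.inl rfl, Or.inr ho⟩
    have h5 := hφ.upward.src_lt_tgt o
    have h6 : (φ.pos (G.src o)).2 ≤ a := by
      by_contra! h6
      have := hel _ hv (G.src o) ⟨h6, (ho ▸ h5).trans h1⟩ e o (Or.inl rfl) (Or.inl rfl) hc
      rw [ho, this] at h5
      exact lt_irrefl _ h5
    obtain ⟨s, hs⟩ := φ.exists_height_eq o (y := y) (h6.trans hy.1.le) (by rw [ho]; exact h4.le)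
    exact ⟨o, s, hc, hs⟩
  · obtain ⟨s, hs⟩ := φ.exists_height_eq e h4 h3
    exact ⟨e, s, Relation.EqvGen.refl _, hs⟩

/-- The order of two edges in different components of an elementary layer depends only on the
component of the first one. -/
lemma rel_of_layerConn (hφ : φ.Realizes r) (hr : G.IsPlanarOrder r) (hab : a < b)
    (hel : φ.IsElementaryLayer a b) (ha : φ.bottom ≤ a) (hb : b ≤ φ.top) {e e' f : E}
    (hf : f ∈ φ.layerEdges a b) (hee : φ.LayerConn a b e' e) (hef : ¬ φ.LayerConn a b e f) :
    (r e' f → r e f) ∧ (r f e' → r f e) := by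
  rcases hel.eq_or_exists_inc hee with rfl | ⟨v, hv, h1, h2⟩
  · exact ⟨id, id⟩
  -- A directed path between `f` and an edge at `v` would put `f` into the component of `v`.
  refine hr.lt_of_inc (hφ.not_isSource ha hv) (hφ.not_isSink hb hv) (fun g hg => ?_) h1 h2
  have hc : φ.LayerConn a b e g := Relation.EqvGen.rel _ _ ⟨v, hv, h2, hg⟩
  have hg' := (hφ.upward.mem_layerEdges hab).1 (mem_layerEdges_of_inc hv hg)
  have hf' := (hφ.upward.mem_layerEdges hab).1 hf
  exact ⟨fun h => hef (hc.trans _ _ _ (hφ.upward.layerConn_of_edgeReach h hg'.2 hf'.1)),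
    fun h => hef (hc.trans _ _ _ ((hφ.upward.layerConn_of_edgeReach h hf'.2 hg'.1).symm _ _))⟩

lemma rel_of_layerConn_of_layerConn (hφ : φ.Realizes r) (hr : G.IsPlanarOrder r) (hab : a < b)
    (hel : φ.IsElementaryLayer a b) (ha : φ.bottom ≤ a) (hb : b ≤ φ.top) {e e' f f' : E}
    (he : e ∈ φ.layerEdges a b) (hf' : f' ∈ φ.layerEdges a b) (hee : φ.LayerConn a b e e')
    (hff : φ.LayerConn a b f f') (hef : ¬ φ.LayerConn a b e f) (h : r e' f') : r e f := by
  have h1 : ¬ φ.LayerConn a b e f' := fun h => hef (h.trans _ _ _ (hff.symm _ _))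
  have h2 := (hφ.rel_of_layerConn hr hab hel ha hb hf' (hee.symm _ _) h1).1 h
  exact (hφ.rel_of_layerConn hr hab hel ha hb he (hff.symm _ _) fun h => hef (h.symm _ _)).2 h2

/-- The order of an elementary layer is the restriction of `r`. -/
lemma layerOrder_iff (hφ : φ.Realizes r) (hr : G.IsPlanarOrder r) (hab : a < b)
    (hel : φ.IsElementaryLayer a b) (ha : φ.bottom ≤ a) (hb : b ≤ φ.top) (e f : E) :
    φ.layerOrder a b e f ↔ e ∈ φ.layerEdges a b ∧ f ∈ φ.layerEdges a b ∧ r e f := by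
  constructor
  · rintro ⟨he, hf, h⟩
    refine ⟨he, hf, ?_⟩
    rcases h with ⟨-, v, hv, h | ⟨-, -, h⟩ | ⟨-, -, h⟩⟩ | ⟨hef, e', f', hee, hff, h⟩
    · exact hr.P₁ _ _ (Relation.TransGen.single (h.1.trans h.2.symm))
    · exact hφ.rel_of_leftOf h
    · exact hφ.rel_of_leftOf h
    · exact hφ.rel_of_layerConn_of_layerConn hr hab hel ha hb he
        (hel.mem_layerEdges hf hff) hee hff hef (hφ.rel_of_leftOf h)
  · rintro ⟨he, hf, h⟩
    refine ⟨he, hf, ?_⟩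
    by_cases hc : φ.LayerConn a b e f
    · refine Or.inl ⟨hc, ?_⟩
      rcases hel.eq_or_exists_inc hc with rfl | ⟨v, hv, h1 | h1, h2 | h2⟩
      · exact absurd h (hr.irrefl e)
      · exact ⟨v, hv, Or.inr (Or.inr ⟨h1, h2, hφ.leftOf_of_src_eq hr hv h1 h2 h⟩)⟩
      · exact absurd h (hr.asymm (hr.P₁ _ _ (Relation.TransGen.single (h2.trans h1.symm))))
      · exact ⟨v, hv, Or.inl ⟨h1, h2⟩⟩
      · exact ⟨v, hv, Or.inr (Or.inl ⟨h1, h2, hφ.leftOf_of_tgt_eq hr hv h1 h2 h⟩)⟩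
    · refine Or.inr ⟨hc, ?_⟩
      -- Components are compared at a height of the layer where `f` is present; the component of `e`
      -- also reaches it.
      obtain ⟨t, ht⟩ := id hf
      obtain ⟨e', s, hee, hs⟩ := hφ.exists_layerConn_height_eq hel ha hb he ht
      have hff := Relation.EqvGen.refl (r := fun e f => ∃ v ∈ φ.layerVerts a b,
        G.Inc e v ∧ G.Inc f v) f
      have hc' : ¬ φ.LayerConn a b e' f := fun h' => hc (hee.trans _ _ _ h')
      have h' : r e' f := (hφ.rel_of_layerConn hr hab hel ha hb hf hee hc').1 h
      refine ⟨e', f, hee, hff, hφ.leftOf_of_rel hr h' (s := s) (t := t) (hs ▸ ht) hs.symm ?_⟩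
      exact fun h0 => hc' (φ.layerConn_of_curve_eq (hs ▸ ht) h0)

/-- Follow a path from `x` as far as it stays below the cut: the last head is no sink, since sinks
are at the top, so an edge leaves it and must cross. -/
lemma exists_reach_cut [Finite E] (hφ : φ.Realizes r) {c : ℝ} (hc : ∀ v, (φ.pos v).2 ≠ c)
    (hct : c < φ.top) {x : E} (hx : (φ.pos (G.tgt x)).2 < c) :
    ∃ g, G.EdgeReach x g ∧ (φ.pos (G.src g)).2 < c ∧ c < (φ.pos (G.tgt g)).2 := by
  obtain ⟨g, ⟨hg1, hg2⟩, hmax⟩ := Set.exists_max_image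
    {g | (x = g ∨ G.EdgeReach x g) ∧ (φ.pos (G.tgt g)).2 < c} (fun g => (φ.pos (G.tgt g)).2)
    (Set.toFinite _) ⟨x, Or.inl rfl, hx⟩
  have hs : ¬ G.IsSink (G.tgt g) := fun h => (hg2.trans hct).ne (hφ.sink _ h)
  simp only [IsSink, not_forall, not_not] at hs
  obtain ⟨o, ho⟩ := hs
  have hxo : G.EdgeReach x o := by
    rcases hg1 with rfl | h
    · exact Relation.TransGen.single ho.symm
    · exact h.tail ho.symm
  have hlt := hφ.upward.src_lt_tgt o
  rw [ho] at hlt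
  refine ⟨o, hxo, by rwa [ho], lt_of_le_of_ne ?_ (hc _).symm⟩
  by_contra! h
  exact hlt.not_ge (hmax o ⟨Or.inr hxo, h⟩)

/-- If `x` lies below and `y` above a cut line and `x` comes before `y`, then some edge crossing the
line comes in between. -/
lemma exists_rel_cut [Finite E] (hφ : φ.Realizes r) (hr : G.IsPlanarOrder r) {c : ℝ}
    (hc : ∀ v, (φ.pos v).2 ≠ c) (hct : c < φ.top) {x y : E} (hx : (φ.pos (G.tgt x)).2 < c)
    (hy : c < (φ.pos (G.src y)).2) (hxy : r x y) :
    ∃ g, r x g ∧ r g y ∧ (φ.pos (G.src g)).2 < c ∧ c < (φ.pos (G.tgt g)).2 := by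
  obtain ⟨g, h1, h2, h3⟩ := hφ.exists_reach_cut hc hct hx
  rcases hr.lt_or_eq_or_gt g y with h | rfl | h
  · exact ⟨g, hr.P₁ _ _ h1, h, h2, h3⟩
  · exact absurd (h2.trans hy) (lt_irrefl _)
  -- Here `x`, `y`, `g` occur in this order with `x → g`. Heights exclude `y → g`, so P₂ gives `x →
  -- y`, and that path crosses the cut before reaching `y`.
  · have h4 : ¬ G.EdgeReach y g := fun h' =>
      ((h2.trans hy).trans (hφ.upward.src_lt_tgt y)).not_ge
        (EdgeReach.le_of_lt (h := fun v => (φ.pos v).2) hφ.upward.src_lt_tgt h')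
    obtain ⟨k, h5, h6, h7⟩ :=
      φ.exists_cut_of_edgeReach hc ((hr.P₂ x y g hxy h h1).resolve_right h4) hx hy
    exact ⟨k, hr.P₁ _ _ h5, hr.P₁ _ _ h6, h7⟩

/-- Gluing the layers below and above a cut line composes the restrictions of `r` to the
restriction of `r`. -/
lemma composeOrder_iff [Finite E] (hφ : φ.Realizes r) (hr : G.IsPlanarOrder r) {c : ℝ}
    (hac : a < c) (hcb : c < b) (hc : ∀ v, (φ.pos v).2 ≠ c) (hct : c < φ.top)
    {r₁ r₂ : E → E → Prop}
    (h₁ : ∀ x y, r₁ x y ↔ x ∈ φ.layerEdges a c ∧ y ∈ φ.layerEdges a c ∧ r x y)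
    (h₂ : ∀ x y, r₂ x y ↔ x ∈ φ.layerEdges c b ∧ y ∈ φ.layerEdges c b ∧ r x y) (x y : E) :
    composeOrder (φ.layerEdges a c) (φ.layerEdges c b) r₁ r₂ x y ↔
      x ∈ φ.layerEdges a b ∧ y ∈ φ.layerEdges a b ∧ r x y := by
  have key : ∀ x ∈ φ.layerEdges a c \ φ.layerEdges c b, ∀ y ∈ φ.layerEdges c b \ φ.layerEdges a c,
      (∃ g ∈ φ.layerEdges a c ∩ φ.layerEdges c b, r₁ x g ∧ r₂ g y) ↔ r x y := by
    rintro x ⟨hx1, hx2⟩ y ⟨hy1, hy2⟩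
    constructor
    · rintro ⟨g, -, hg1, hg2⟩
      exact hr.trans ((h₁ _ _).1 hg1).2.2 ((h₂ _ _).1 hg2).2.2
    · intro hxy
      have hx1' := (hφ.upward.mem_layerEdges hac).1 hx1
      have hy1' := (hφ.upward.mem_layerEdges hcb).1 hy1
      rw [hφ.upward.mem_layerEdges hcb, not_and, not_lt] at hx2
      rw [hφ.upward.mem_layerEdges hac, not_and', not_lt] at hy2
      have hx := lt_of_le_of_ne (hx2 (hx1'.1.trans hcb)) (hc _)
      have hy := lt_of_le_of_ne (hy2 (hac.trans hy1'.2)) (hc _).symm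
      obtain ⟨g, hg1, hg2, hg3, hg4⟩ := hφ.exists_rel_cut hr hc hct hx hy hxy
      have hga : g ∈ φ.layerEdges a c := (hφ.upward.mem_layerEdges hac).2 ⟨hg3, hac.trans hg4⟩
      have hgb : g ∈ φ.layerEdges c b := (hφ.upward.mem_layerEdges hcb).2 ⟨hg3.trans hcb, hg4⟩
      exact ⟨g, ⟨hga, hgb⟩, (h₁ _ _).2 ⟨hx1, hga, hg1⟩, (h₂ _ _).2 ⟨hgb, hy1, hg2⟩⟩
  have union : ∀ x, x ∈ φ.layerEdges a b ↔ x ∈ φ.layerEdges a c ∨ x ∈ φ.layerEdges c b := by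
    intro x
    rw [hφ.upward.mem_layerEdges (hac.trans hcb), hφ.upward.mem_layerEdges hac,
      hφ.upward.mem_layerEdges hcb]
    have := hφ.upward.src_lt_tgt x
    constructor
    · rintro ⟨h1, h2⟩
      rcases lt_or_ge (φ.pos (G.src x)).2 c with h3 | h3
      · exact Or.inl ⟨h3, h2⟩
      · exact Or.inr ⟨h1, h3.trans_lt this⟩
    · rintro (⟨h1, h2⟩ | ⟨h1, h2⟩)
      · exact ⟨h1.trans hcb, h2⟩
      · exact ⟨h1, hac.trans h2⟩
  rw [union, union, composeOrder, h₁, h₂]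
  by_cases hx1 : x ∈ φ.layerEdges a c <;> by_cases hx2 : x ∈ φ.layerEdges c b <;>
    by_cases hy1 : y ∈ φ.layerEdges a c <;> by_cases hy2 : y ∈ φ.layerEdges c b <;>
    simp only [hx1, hx2, hy1, hy2, Set.mem_sdiff, true_and, and_true, false_and, and_false,
      or_true, or_false, false_or, or_self, not_true, not_false_iff, and_self]
  · rw [key x ⟨hx1, hx2⟩ y ⟨hy2, hy1⟩]
  -- The last clause of `composeOrder` negates the glued-edge condition for the reversed pair, so
  -- linearity of `r` is needed.
  · rw [key y ⟨hy1, hy2⟩ x ⟨hx2, hx1⟩]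
    constructor
    · intro h
      rcases hr.lt_or_eq_or_gt x y with h' | rfl | h'
      · exact h'
      · exact absurd hy1 hx1
      · exact absurd h' h
    · exact hr.asymm

/-- The composite of the orders of the layers is `r`, for every elementary decomposition. -/
theorem order_eq [Finite E] (hφ : φ.Realizes r) (hr : G.IsPlanarOrder r)
    (d : φ.ElementaryDecomposition) : d.order = r := by
  have mono : ∀ j k, j ≤ k → k ≤ d.n + 1 → d.height j ≤ d.height k := by
    intro j k hjk
    induction k, hjk using Nat.le_induction with
    | base => exact fun _ => le_rfl
    | succ k _ ih => exact fun hk => (ih (by omega)).trans (d.height_lt k (by omega)).le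
  have key : ∀ k ≤ d.n, ∀ x y, φ.composedOrder d.height k x y ↔
      x ∈ φ.layerEdges (d.height 0) (d.height (k + 1)) ∧
      y ∈ φ.layerEdges (d.height 0) (d.height (k + 1)) ∧ r x y := by
    have layer : ∀ k ≤ d.n, ∀ x y, φ.layerOrder (d.height k) (d.height (k + 1)) x y ↔
        x ∈ φ.layerEdges (d.height k) (d.height (k + 1)) ∧
        y ∈ φ.layerEdges (d.height k) (d.height (k + 1)) ∧ r x y := fun k hk =>
      hφ.layerOrder_iff hr (d.height_lt k hk) (d.elementary k hk)
        (d.height_zero ▸ mono 0 k (by omega) (by omega))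
        (d.height_last ▸ mono (k + 1) (d.n + 1) (by omega) (by omega))
    intro k
    induction k with
    | zero => exact layer 0
    | succ k ih =>
      intro hk
      exact hφ.composeOrder_iff hr
        ((mono 0 k (by omega) (by omega)).trans_lt (d.height_lt k (by omega)))
        (d.height_lt (k + 1) hk) (d.no_vertex (k + 1) (by omega) hk)
        (((d.height_lt (k + 1) hk)).trans_le (d.height_last ▸ mono _ _ (by omega) le_rfl))
        (ih (by omega)) (layer (k + 1) hk)
  have all : ∀ x, x ∈ φ.layerEdges (d.height 0) (d.height (d.n + 1)) := by
    intro x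
    rw [d.height_zero, d.height_last, hφ.upward.mem_layerEdges φ.bottom_lt_top]
    have h := hφ.upward.src_lt_tgt x
    exact ⟨h.trans_le (φ.pos_mem _).2.2, (φ.pos_mem _).2.1.trans_lt h⟩
  ext x y
  exact (key d.n le_rfl x y).trans ⟨fun h => h.2.2, fun h => ⟨all x, all y, h⟩⟩

end Realizes
end BPEmbedding

/-! ### Levels and columns from a planar order. -/

/-- Combinatorial data for a drawing: `rank` numbers the edges along `r` and `level` is the height
of a vertex, which is placed in the column of its edge `anchor`. -/
structure LevelData (G : DirGraph V E) (r : E → E → Prop) where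
  size : ℕ
  rank : E → ℕ
  level : V → ℕ
  anchor : V → E
  rel_iff : ∀ e f, r e f ↔ rank e < rank f
  rank_injective : Function.Injective rank
  rank_lt : ∀ e, rank e < size
  level_lt : ∀ e, level (G.src e) < level (G.tgt e)
  level_source : ∀ v, G.IsSource v → level v = 0
  level_sink : ∀ v, G.IsSink v → level v = size + 1
  level_pos : ∀ v, ¬ G.IsSource v → 0 < level v
  level_lt_size : ∀ v, ¬ G.IsSink v → level v < size + 1
  level_inj : ∀ v w, ¬ G.IsSource v → ¬ G.IsSink v → ¬ G.IsSource w → ¬ G.IsSink w →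
    level v = level w → v = w
  inc_anchor : ∀ v, G.Inc (anchor v) v

/-- Levels increase along `e` because every edge into its tail precedes `e`, while `e` is at most
the last edge into its head. Distinct inner vertices have distinct last incoming edges, hence
distinct levels. -/
theorem LevelData.nonempty [Finite E] (hG : G.IsProgressive) {r : E → E → Prop}
    (hr : G.IsPlanarOrder r) : Nonempty (LevelData G r) := by
  let rank : E → ℕ := fun e => {g | r g e}.ncard
  have mono : ∀ e f, r e f → rank e < rank f := fun e f h =>
    Set.ncard_lt_ncard ⟨fun g hg => hr.trans hg h, fun h' => hr.irrefl e (h' h)⟩ (Set.toFinite _)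
  have rel_iff : ∀ e f, r e f ↔ rank e < rank f := by
    refine fun e f => ⟨mono e f, fun h => ?_⟩
    rcases hr.lt_or_eq_or_gt e f with h' | rfl | h'
    · exact h'
    · exact absurd h (lt_irrefl _)
    · exact absurd h (mono f e h').asymm
  have rank_inj : Function.Injective rank := by
    intro e f h
    rcases hr.lt_or_eq_or_gt e f with h' | h' | h'
    · exact absurd h (mono e f h').ne
    · exact h'
    · exact absurd h (mono f e h').ne'
  have rank_lt : ∀ e, rank e < Nat.card E := by
    intro e
    rw [← Set.ncard_univ]
    exact Set.ncard_lt_ncard ⟨Set.subset_univ _, fun h => hr.irrefl e (h (Set.mem_univ e))⟩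
      (Set.toFinite _)
  have ex : ∀ v, ∃ m : ℕ, (G.IsSource v → m = 0) ∧ (G.IsSink v → m = Nat.card E + 1) ∧
      (¬ G.IsSource v → ¬ G.IsSink v → ∃ e, G.tgt e = v ∧ m = rank e + 1 ∧
        ∀ g, G.tgt g = v → rank g ≤ rank e) := by
    intro v
    by_cases h1 : G.IsSource v
    · exact ⟨0, fun _ => rfl, fun h => absurd h (hG.not_isSink_of_isSource h1),
        fun h => absurd h1 h⟩
    by_cases h2 : G.IsSink v
    · exact ⟨_, fun h => absurd h h1, fun _ => rfl, fun _ h => absurd h2 h⟩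
    have h3 := h1
    simp only [IsSource, not_forall, not_not] at h3
    obtain ⟨e, he, hmax⟩ := Set.exists_max_image {e | G.tgt e = v} rank (Set.toFinite _) h3
    exact ⟨_, fun h => absurd h h1, fun h => absurd h h2, fun _ _ => ⟨e, he, rfl, hmax⟩⟩
  choose level lsource lsink linner using ex
  choose anchor hanchor using hG.exists_inc
  have lpos : ∀ v, ¬ G.IsSource v → 0 < level v := by
    intro v hv
    by_cases h : G.IsSink v
    · rw [lsink v h]
      omega
    · obtain ⟨e, -, h, -⟩ := linner v hv h
      omega
  have llt : ∀ v, ¬ G.IsSink v → level v < Nat.card E + 1 := by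
    intro v hv
    by_cases h : G.IsSource v
    · rw [lsource v h]
      omega
    · obtain ⟨e, -, h, -⟩ := linner v h hv
      have := rank_lt e
      omega
  refine ⟨⟨Nat.card E, rank, level, anchor, rel_iff, rank_inj, rank_lt, fun e => ?_, lsource, lsink,
    lpos, llt, fun v w h1 h2 h3 h4 h => ?_, hanchor⟩⟩
  · have h1 : ¬ G.IsSink (G.src e) := fun h => h e rfl
    have h2 : ¬ G.IsSource (G.tgt e) := fun h => h e rfl
    by_cases h3 : G.IsSource (G.src e)
    · rw [lsource _ h3]
      exact lpos _ h2
    by_cases h4 : G.IsSink (G.tgt e)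
    · rw [lsink _ h4]
      exact llt _ h1
    obtain ⟨f, hf, hf', -⟩ := linner _ h3 h1
    obtain ⟨g, -, hg', hg⟩ := linner _ h2 h4
    have h5 := mono f e (hr.P₁ _ _ (Relation.TransGen.single hf))
    have h6 := hg e rfl
    omega
  · obtain ⟨e, he, he', -⟩ := linner v h1 h2
    obtain ⟨f, hf, hf', -⟩ := linner w h3 h4
    rw [← he, ← hf, rank_inj (show rank e = rank f by omega)]

namespace LevelData

variable {r : E → E → Prop} (D : LevelData G r)

lemma level_le (v : V) : D.level v ≤ D.size + 1 := by
  by_cases h : G.IsSink v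
  · exact (D.level_sink v h).le
  · exact (D.level_lt_size v h).le

/-- The abscissa of a vertex is the rank of its anchor edge. -/
def column (v : V) : ℝ := D.rank (D.anchor v)

/-- At the level `k` the edge `e` has abscissa `p`: either it ends there, or it passes vertically. -/
def AtLevel (e : E) (k : ℕ) (p : ℝ) : Prop :=
  (∃ v, G.Inc e v ∧ D.level v = k ∧ p = D.column v) ∨
  (D.level (G.src e) < k ∧ k < D.level (G.tgt e) ∧ p = D.rank e)

variable {D}

/-- The two extreme levels contain only sources or only sinks, whose single edge is their anchor;
every other level contains at most one vertex. -/
lemma eq_of_level_eq (hG : G.IsProgressive) {v w : V} (h : D.level v = D.level w) {e f : E}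
    (he : G.Inc e v) (hf : G.Inc f w) :
    v = w ∨ (D.column v = D.rank e ∧ D.column w = D.rank f) := by
  have hv := D.inc_anchor v
  have hw := D.inc_anchor w
  have key : (G.IsSource v ↔ G.IsSource w) ∧ (G.IsSink v ↔ G.IsSink w) := by
    have h1 := D.level_source v
    have h2 := D.level_source w
    have h3 := D.level_sink v
    have h4 := D.level_sink w
    have h5 := D.level_pos v
    have h6 := D.level_pos w
    have h7 := D.level_lt_size v
    have h8 := D.level_lt_size w
    refine ⟨⟨fun h => ?_, fun h => ?_⟩, fun h => ?_, fun h => ?_⟩ <;> by_contra h' <;> grind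
  unfold column
  by_cases h1 : G.IsSource v
  · exact Or.inr ⟨by rw [h1.eq_of_inc hG hv he], by rw [(key.1.1 h1).eq_of_inc hG hw hf]⟩
  by_cases h2 : G.IsSink v
  · exact Or.inr ⟨by rw [h2.eq_of_inc hG hv he], by rw [(key.2.1 h2).eq_of_inc hG hw hf]⟩
  exact Or.inl (D.level_inj v w h1 h2 (by rwa [← key.1]) (by rwa [← key.2]) h)

/-- An edge passing the level of a vertex `v` is on the same side of all edges at `v`. -/
lemma lt_of_passing (hr : G.IsPlanarOrder r) {v : V} {e f : E} (he : G.Inc e v)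
    (h1 : D.level (G.src f) < D.level v) (h2 : D.level v < D.level (G.tgt f)) :
    (r e f → D.column v < D.rank f) ∧ (r f e → D.rank f < D.column v) := by
  have hs : ¬ G.IsSource v := fun h => by
    rw [D.level_source v h] at h1
    exact Nat.not_lt_zero _ h1
  have ht : ¬ G.IsSink v := fun h => by
    rw [D.level_sink v h] at h2
    exact absurd (D.level_le _) h2.not_ge
  have := hr.lt_of_inc hs ht (fun g hg => not_edgeReach_of_between D.level_lt h1 h2 hg) he
    (D.inc_anchor v)
  simpa [column, D.rel_iff] using this

lemma AtLevel.lt (hG : G.IsProgressive) (hr : G.IsPlanarOrder r) {e f : E} (hef : r e f) {k : ℕ}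
    {p q : ℝ} (hp : D.AtLevel e k p) (hq : D.AtLevel f k q) :
    p < q ∨ p = q ∧ ∃ v, G.Inc e v ∧ G.Inc f v ∧ D.level v = k ∧ p = D.column v := by
  have hef' : (D.rank e : ℝ) < D.rank f := by exact_mod_cast (D.rel_iff e f).1 hef
  rcases hp with ⟨v, hv, hvk, rfl⟩ | ⟨h1, h2, rfl⟩ <;>
    rcases hq with ⟨w, hw, hwk, rfl⟩ | ⟨h3, h4, rfl⟩
  · rcases eq_of_level_eq hG (hvk.trans hwk.symm) hv hw with rfl | ⟨h1, h2⟩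
    · exact Or.inr ⟨rfl, v, hv, hw, hvk, rfl⟩
    · exact Or.inl (by rwa [h1, h2])
  · subst hvk
    exact Or.inl ((lt_of_passing hr hv h3 h4).1 hef)
  · subst hwk
    exact Or.inl ((lt_of_passing hr hw h1 h2).2 hef)
  · exact Or.inl hef'

lemma AtLevel.mem_Icc {e : E} {k : ℕ} {p : ℝ} (hp : D.AtLevel e k p) :
    p ∈ Set.Icc (0 : ℝ) D.size := by
  rcases hp with ⟨v, -, -, rfl⟩ | ⟨-, -, rfl⟩ <;>
    exact ⟨Nat.cast_nonneg _, Nat.cast_le.2 (D.rank_lt _).le⟩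

/-! ### Bending the edges. -/

/-- The tent function of width one. -/
noncomputable def tent (u : ℝ) : ℝ := max 0 (1 - 2 * |u|)

lemma continuous_tent : Continuous tent := by
  unfold tent
  fun_prop

lemma tent_zero : tent 0 = 1 := by simp [tent]

lemma tent_nonneg (u : ℝ) : 0 ≤ tent u := le_max_left _ _

lemma tent_le_one (u : ℝ) : tent u ≤ 1 :=
  max_le zero_le_one (by linarith [abs_nonneg u])

/-- Levels are integers, so at each height at most one of the bends at different levels is active.
-/
lemma tent_eq_zero {u : ℝ} (h : 1 / 2 ≤ |u|) : tent u = 0 := max_eq_left (by linarith)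

lemma eq_zero_of_tent_eq_one {u : ℝ} (h : tent u = 1) : u = 0 := by
  by_contra h0
  have := abs_pos.2 h0
  exact (max_lt one_pos (by linarith) : tent u < 1).ne h

variable (D) in
/-- The abscissa of the edge `e` at the height `y`: the edge runs vertically in the column of its
rank, and bends linearly towards its end vertices. -/
noncomputable def abscissa (e : E) (y : ℝ) : ℝ :=
  D.rank e + (D.column (G.src e) - D.rank e) * tent (y - D.level (G.src e)) +
    (D.column (G.tgt e) - D.rank e) * tent (y - D.level (G.tgt e))

lemma level_add_one_le (D : LevelData G r) (e : E) :
    (D.level (G.src e) : ℝ) + 1 ≤ D.level (G.tgt e) := by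
  exact_mod_cast D.level_lt e

lemma abscissa_src (e : E) : D.abscissa e (D.level (G.src e)) = D.column (G.src e) := by
  have h := D.level_add_one_le e
  rw [abscissa, sub_self, tent_zero, tent_eq_zero (by rw [abs_of_neg] <;> linarith)]
  ring

lemma abscissa_tgt (e : E) : D.abscissa e (D.level (G.tgt e)) = D.column (G.tgt e) := by
  have h := D.level_add_one_le e
  rw [abscissa, sub_self, tent_zero, tent_eq_zero (by rw [abs_of_pos] <;> linarith)]
  ring

lemma continuous_abscissa (e : E) : Continuous (D.abscissa e) := by
  have := continuous_tent
  unfold abscissa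
  fun_prop

/-- Near the level `k`, the abscissa of an edge interpolates between its rank and its abscissa at
that level. -/
lemma exists_abscissa_eq {e : E} {y : ℝ} (h1 : D.level (G.src e) ≤ y) (h2 : y ≤ D.level (G.tgt e))
    {k : ℕ} (hk : (k : ℝ) ≤ y + 1 / 2) (hk' : y + 1 / 2 < k + 1) : ∃ p, D.AtLevel e k p ∧
      D.abscissa e y = (1 - tent (y - k)) * D.rank e + tent (y - k) * p := by
  have h := D.level_add_one_le e
  have far : ∀ m : ℕ, m ≠ k → tent (y - m) = 0 := by
    intro m hm
    apply tent_eq_zero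
    rw [le_abs]
    rcases lt_or_gt_of_ne hm with hm | hm
    · have : (m : ℝ) + 1 ≤ k := by exact_mod_cast hm
      left
      linarith
    · have : (k : ℝ) + 1 ≤ m := by exact_mod_cast hm
      right
      linarith
  have hlt := D.level_lt e
  by_cases hs : D.level (G.src e) = k
  · refine ⟨_, Or.inl ⟨_, Or.inl rfl, hs, rfl⟩, ?_⟩
    rw [abscissa, far (D.level (G.tgt e)) (by omega), hs]
    ring
  by_cases ht : D.level (G.tgt e) = k
  · refine ⟨_, Or.inl ⟨_, Or.inr rfl, ht, rfl⟩, ?_⟩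
    rw [abscissa, far (D.level (G.src e)) (by omega), ht]
    ring
  refine ⟨_, Or.inr ⟨lt_of_le_of_ne ?_ hs, lt_of_le_of_ne ?_ (Ne.symm ht), rfl⟩, ?_⟩
  · have : (D.level (G.src e) : ℝ) < k + 1 := by linarith
    exact Nat.lt_succ_iff.1 (by exact_mod_cast this)
  · have : (k : ℝ) < D.level (G.tgt e) + 1 := by linarith
    exact Nat.lt_succ_iff.1 (by exact_mod_cast this)
  · rw [abscissa, far _ hs, far _ ht]
    ring

lemma exists_nearest {y : ℝ} (hy : 0 ≤ y) : ∃ k : ℕ, (k : ℝ) ≤ y + 1 / 2 ∧ y + 1 / 2 < k + 1 :=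
  ⟨⌊y + 1 / 2⌋₊, Nat.floor_le (by linarith), Nat.lt_floor_add_one _⟩

lemma abscissa_mem_Icc {e : E} {y : ℝ} (h1 : D.level (G.src e) ≤ y)
    (h2 : y ≤ D.level (G.tgt e)) : D.abscissa e y ∈ Set.Icc (0 : ℝ) D.size := by
  obtain ⟨k, hk, hk'⟩ := exists_nearest ((Nat.cast_nonneg _).trans h1)
  obtain ⟨p, hp, h⟩ := exists_abscissa_eq h1 h2 hk hk'
  rw [h]
  exact convex_Icc _ _ ⟨Nat.cast_nonneg _, Nat.cast_le.2 (D.rank_lt _).le⟩ hp.mem_Icc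
    (sub_nonneg.2 (tent_le_one _)) (tent_nonneg _) (by ring)

/-- At every height the edges are ordered from left to right by `r`, unless they meet at a common
end vertex. -/
lemma abscissa_lt (hG : G.IsProgressive) (hr : G.IsPlanarOrder r) {e f : E} (hef : r e f) {y : ℝ}
    (he : D.level (G.src e) ≤ y) (he' : y ≤ D.level (G.tgt e))
    (hf : D.level (G.src f) ≤ y) (hf' : y ≤ D.level (G.tgt f)) :
    D.abscissa e y < D.abscissa f y ∨ D.abscissa e y = D.abscissa f y ∧
      ∃ v, D.level v = y ∧ D.abscissa e y = D.column v := by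
  obtain ⟨k, hk, hk'⟩ := exists_nearest ((Nat.cast_nonneg _).trans he)
  obtain ⟨p, hp, h1⟩ := exists_abscissa_eq he he' hk hk'
  obtain ⟨q, hq, h2⟩ := exists_abscissa_eq hf hf' hk hk'
  have hlt : (D.rank e : ℝ) < D.rank f := by exact_mod_cast (D.rel_iff e f).1 hef
  have hpq := hp.lt hG hr hef hq
  have hle : p ≤ q := by
    rcases hpq with h | h
    · exact h.le
    · exact h.1.le
  have t0 := tent_nonneg (y - k)
  -- Off the level, the strictly ordered ranks have positive weight, which makes the inequality
  -- strict. On it, only the abscissas at level `k` count.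
  rcases (tent_le_one (y - k)).lt_or_eq with h | h
  · left
    rw [h1, h2]
    exact add_lt_add_of_lt_of_le (mul_lt_mul_of_pos_left hlt (by linarith))
      (mul_le_mul_of_nonneg_left hle t0)
  · simp only [h, sub_self, zero_mul, one_mul, zero_add] at h1 h2
    rw [h1, h2]
    rcases hpq with h' | ⟨h', v, -, -, hv, hv'⟩
    · exact Or.inl h'
    · refine Or.inr ⟨h', v, ?_, hv'⟩
      rw [hv]
      linarith [eq_zero_of_tent_eq_one h]

/-- At this height `e` is in its own column. Sharing it with `v` would make `e` the anchor of `v`,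
hence `v` an end of `e`. -/
lemma abscissa_ne_column {e : E} {v : V} (h1 : D.level (G.src e) < D.level v)
    (h2 : D.level v < D.level (G.tgt e)) : D.abscissa e (D.level v) ≠ D.column v := by
  intro h
  obtain ⟨p, hp, hp'⟩ := exists_abscissa_eq (D := D) (e := e) (y := D.level v) (k := D.level v)
    (by exact_mod_cast h1.le) (by exact_mod_cast h2.le) (by linarith) (by linarith)
  rw [h, sub_self, tent_zero] at hp'
  rcases hp with ⟨w, hw | hw, hwk, -⟩ | ⟨-, -, rfl⟩
  · exact h1.ne (by rw [hw, hwk])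
  · exact h2.ne' (by rw [hw, hwk])
  · have h3 : D.anchor v = e := D.rank_injective (by
      have : (D.rank (D.anchor v) : ℝ) = D.rank e := by simpa [column] using hp'
      exact_mod_cast this)
    rcases D.inc_anchor v with h4 | h4 <;> rw [h3] at h4
    · exact h1.ne (by rw [h4])
    · exact h2.ne' (by rw [h4])

/-! ### The drawing and its elementary decomposition. -/

variable (D) in
/-- The height of the point of the edge `e` with parameter `s`. -/
noncomputable def height (e : E) (s : unitInterval) : ℝ :=
  D.level (G.src e) + s * (D.level (G.tgt e) - D.level (G.src e))

lemma height_strictMono (e : E) : StrictMono (D.height e) := by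
  intro s t hst
  have h := D.level_add_one_le e
  have : (s : ℝ) < t := hst
  have := mul_lt_mul_of_pos_right this
    (show (0 : ℝ) < D.level (G.tgt e) - D.level (G.src e) by linarith)
  simpa [height] using this

lemma height_zero (e : E) : D.height e 0 = D.level (G.src e) := by simp [height]

lemma height_one (e : E) : D.height e 1 = D.level (G.tgt e) := by simp [height]

lemma le_height (e : E) (s : unitInterval) : D.level (G.src e) ≤ D.height e s :=
  (D.height_zero e).ge.trans ((height_strictMono e).monotone s.2.1)

lemma height_le (e : E) (s : unitInterval) : D.height e s ≤ D.level (G.tgt e) :=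
  ((height_strictMono e).monotone s.2.2).trans (D.height_one e).le

variable (D) in
/-- The position of a vertex in the drawing. -/
def point (v : V) : ℝ × ℝ := (D.column v, D.level v)

variable (D) in
/-- The arc drawn for an edge. -/
noncomputable def arc (e : E) : Path (D.point (G.src e)) (D.point (G.tgt e)) where
  toFun s := (D.abscissa e (D.height e s), D.height e s)
  continuous_toFun := by
    have := D.continuous_abscissa e
    unfold height
    fun_prop
  source' := by simp [height_zero, abscissa_src, point]
  target' := by simp [height_one, abscissa_tgt, point]

lemma arc_apply (e : E) (s : unitInterval) :
    D.arc e s = (D.abscissa e (D.height e s), D.height e s) := rfl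

lemma arc_ne_point (e : E) (v : V) {s : unitInterval} (hs : s ∈ Set.Ioo (0 : unitInterval) 1) :
    D.arc e s ≠ D.point v := by
  intro h
  rw [arc_apply, point, Prod.mk.injEq] at h
  have h1 := height_strictMono (D := D) e hs.1
  have h2 := height_strictMono (D := D) e hs.2
  rw [height_zero, h.2] at h1
  rw [height_one, h.2] at h2
  rw [h.2] at h
  exact abscissa_ne_column (by exact_mod_cast h1) (by exact_mod_cast h2) h.1

lemma arc_lt (hG : G.IsProgressive) (hr : G.IsPlanarOrder r) {e f : E} (hef : r e f)
    {s t : unitInterval} (h : (D.arc e s).2 = (D.arc f t).2) :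
    (D.arc e s).1 < (D.arc f t).1 ∨ D.arc e s = D.arc f t ∧ ∃ v, D.arc e s = D.point v := by
  change D.height e s = D.height f t at h
  rw [arc_apply, arc_apply]
  have h1 := le_height (D := D) f t
  have h2 := height_le (D := D) f t
  rw [← h] at h1 h2 ⊢
  rcases abscissa_lt hG hr hef (le_height e s) (height_le e s) h1 h2 with h3 | ⟨h3, v, hv, hv'⟩
  · exact Or.inl h3
  · exact Or.inr ⟨by rw [h3], v, by rw [hv', ← hv, point]⟩

/-- Distinct vertices on one level and in one column would share their anchor edge, but the two ends
of an edge have different levels. -/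
lemma point_injective (hG : G.IsProgressive) : Function.Injective D.point := by
  intro v w h
  simp only [point, Prod.mk.injEq, Nat.cast_inj] at h
  rcases eq_of_level_eq hG h.2 (D.inc_anchor v) (D.inc_anchor w) with h1 | -
  · exact h1
  have h2 : D.anchor v = D.anchor w := D.rank_injective (by
    have := h.1
    simpa [column] using this)
  have hv := D.inc_anchor v
  have hw := D.inc_anchor w
  have hlt := D.level_lt (D.anchor v)
  rw [← h2] at hw
  rcases hv with hv | hv <;> rcases hw with hw | hw
  · exact hv.symm.trans hw
  · rw [hv, hw, h.2] at hlt
    exact absurd hlt (lt_irrefl _)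
  · rw [hv, hw, h.2] at hlt
    exact absurd hlt (lt_irrefl _)
  · exact hv.symm.trans hw

variable (D) in
/-- The drawing of a progressive graph given by level data for a planar order. -/
noncomputable def drawing (hG : G.IsProgressive) (hr : G.IsPlanarOrder r) : G.BPEmbedding where
  pos := D.point
  curve := D.arc
  pos_injective := point_injective hG
  curve_injective e s t h := (height_strictMono e).injective (congrArg Prod.snd h)
  curve_ne_pos e v s hs := arc_ne_point e v hs
  curve_disjoint e f s hs t ht h := by
    rcases hr.lt_or_eq_or_gt e f with hef | hef | hef
    · rcases arc_lt hG hr hef (congrArg Prod.snd h) with h' | ⟨-, v, hv⟩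
      · exact absurd (congrArg Prod.fst h) h'.ne
      · exact absurd hv (arc_ne_point e v hs)
    · exact hef
    · rcases arc_lt hG hr hef (congrArg Prod.snd h.symm) with h' | ⟨-, v, hv⟩
      · exact absurd (congrArg Prod.fst h) h'.ne'
      · exact absurd hv (arc_ne_point f v ht)
  -- Not 0: the box needs positive width even when there are no edges.
  left := -1
  right := D.size
  bottom := 0
  top := D.size + 1
  left_lt_right := by linarith [Nat.cast_nonneg (α := ℝ) D.size]
  bottom_lt_top := by positivity
  pos_mem v := by
    refine ⟨⟨?_, Nat.cast_le.2 (D.rank_lt _).le⟩, Nat.cast_nonneg _, ?_⟩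
    · exact le_trans (by norm_num) (Nat.cast_nonneg (α := ℝ) (D.rank (D.anchor v)))
    · change (D.level v : ℝ) ≤ D.size + 1
      exact_mod_cast D.level_le v
  curve_mem e s := by
    have h := abscissa_mem_Icc (le_height (D := D) e s) (height_le e s)
    refine ⟨⟨le_trans (by norm_num) h.1, h.2⟩, (Nat.cast_nonneg _).trans (le_height e s),
      (height_le e s).trans ?_⟩
    exact_mod_cast D.level_le _
  sides := Or.inl ⟨fun v hv => by simp [point, D.level_source v hv],
    fun v hv => by simp [point, D.level_sink v hv]⟩

variable (hG : G.IsProgressive) (hr : G.IsPlanarOrder r)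

lemma drawing_realizes : (D.drawing hG hr).Realizes r where
  upward := height_strictMono
  source v hv := by simp [drawing, point, D.level_source v hv]
  sink v hv := by simp [drawing, point, D.level_sink v hv]
  rel_of_left e f s t h h' := by
    rcases hr.lt_or_eq_or_gt e f with hef | rfl | hef
    · exact hef
    · rw [(D.height_strictMono e).injective h] at h'
      exact absurd h' (lt_irrefl _)
    · rcases arc_lt hG hr hef h with h1 | ⟨h1, -⟩
      · exact absurd h' h1.asymm
      · exact absurd (congrArg Prod.fst h1) h'.ne'

/-- Cutting the drawing at the half-integral heights gives elementary layers. -/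
lemma drawing_decomposition : Nonempty (D.drawing hG hr).ElementaryDecomposition := by
  have hN : (0 : ℝ) ≤ D.size := Nat.cast_nonneg _
  -- Layer `k` surrounds level `k`; clamping turns the outermost values into the bottom and the top
  -- of the box.
  refine ⟨⟨D.size + 1, fun k => max 0 (min (D.size + 1) (k - 1 / 2)), ?_, ?_, ?_, ?_, ?_⟩⟩
  · rw [Nat.cast_zero, max_eq_left]
    · rfl
    · exact (min_le_right _ _).trans (by norm_num)
  · push_cast
    rw [min_eq_left (by linarith), max_eq_right (by linarith)]
    rfl
  · intro k hk
    have hk' : (k : ℝ) ≤ D.size + 1 := by exact_mod_cast hk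
    have hk0 : (0 : ℝ) ≤ k := Nat.cast_nonneg _
    push_cast
    refine max_lt (lt_max_of_lt_right (lt_min (by linarith) (by linarith)))
      (lt_max_of_lt_right (lt_min ?_ ?_))
    · exact (min_le_right _ _).trans_lt (by linarith)
    · exact (min_le_right _ _).trans_lt (by linarith)
  · intro k hk1 hk2 v h
    have hk1' : (1 : ℝ) ≤ k := by exact_mod_cast hk1
    have hk2' : (k : ℝ) ≤ D.size + 1 := by exact_mod_cast hk2
    rw [min_eq_right (by linarith), max_eq_right (by linarith)] at h
    have h1 : (D.level v : ℝ) = k - 1 / 2 := h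
    have h2 : 2 * D.level v + 1 = 2 * k := by
      have : (2 * D.level v + 1 : ℝ) = 2 * k := by linarith
      exact_mod_cast this
    omega
  · intro k hk u hu v hv e f he hf _
    -- Layers have height at most 1, so two integral levels in one open layer agree. Connectedness
    -- of the edges plays no role.
    have h0 : max (0 : ℝ) (min (D.size + 1) ((k + 1 : ℕ) - 1 / 2)) ≤
        max (0 : ℝ) (min (D.size + 1) (k - 1 / 2)) + 1 := by
      push_cast
      refine max_le (by positivity) (le_trans ?_ (add_le_add_left (le_max_right _ _) 1))
      rw [← min_add_add_right]
      exact min_le_min (by linarith) (by linarith)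
    have inner : ∀ u ∈ (D.drawing hG hr).layerVerts (max 0 (min (D.size + 1) (k - 1 / 2)))
        (max 0 (min (D.size + 1) ((k + 1 : ℕ) - 1 / 2))), ¬ G.IsSource u ∧ ¬ G.IsSink u := by
      intro u hu
      constructor
      · intro h
        have h1 := (le_max_left _ _).trans_lt hu.1
        exact h1.ne' ((drawing_realizes hG hr).source u h)
      · intro h
        have h1 := hu.2.trans_le (max_le (by linarith) (min_le_left _ _))
        exact h1.ne ((drawing_realizes hG hr).sink u h)
    refine D.level_inj u v (inner u hu).1 (inner u hu).2 (inner v hv).1 (inner v hv).2 ?_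
    have hu1 : _ < (D.level u : ℝ) := hu.1
    have hu2 : (D.level u : ℝ) < _ := hu.2
    have hv1 : _ < (D.level v : ℝ) := hv.1
    have hv2 : (D.level v : ℝ) < _ := hv.2
    have h1 : (D.level u : ℝ) < D.level v + 1 := by linarith
    have h2 : (D.level v : ℝ) < D.level u + 1 := by linarith
    exact le_antisymm (Nat.lt_succ_iff.1 (by exact_mod_cast h1))
      (Nat.lt_succ_iff.1 (by exact_mod_cast h2))

end LevelData

end DirGraph

theorem proposition1p2 {V E : Type*} [Finite V] [Finite E] (G : DirGraph V E)
    (hG : G.IsProgressive) (r : E → E → Prop) (hr : G.IsPlanarOrder r) :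
    ∃ φ : G.BPEmbedding, φ.IsUpward ∧ φ.Induces r := by
  obtain ⟨D⟩ := DirGraph.LevelData.nonempty hG hr
  have h := DirGraph.LevelData.drawing_realizes (D := D) hG hr
  exact ⟨D.drawing hG hr, h.upward, D.drawing_decomposition hG hr, fun d => h.order_eq hr d⟩
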